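/- Let $k\in\mathbb N$ and let $\Lambda$ be a countable finitely aligned $k$-graph, that is, a small category with countably many morphisms and a functor $d:\Lambda\to\mathbb N^k$ with the unique factorisation property (if $d(\lambda)=m+n$ then $\lambda=\mu\nu$ for unique $\mu,\nu$ with $d(\mu)=m$, $d(\nu)=n$), such that for all $\mu,\nu\in\Lambda$ the set $\Lambda^{\min}(\mu,\nu)=\{(\alpha,\beta):\mu\alpha=\nu\beta,\ d(\mu\alpha)=d(\mu)\vee d(\nu)\}$ is finite. Write $r,s$ for range and source. For $m\in(\mathbb N\cup\{\infty\})^k$, let $\Omega_{k,m}$ be the category with objects $\{n\in\mathbb N^k:n\le m\}$ and one morphism $(p,q)$, of range $p$, source $q$ and degree $q-p$, for all $p\le q\le m$. Let $\partial\Lambda$ be the set of boundary paths: the degree-preserving functors $x:\Omega_{k,m}\to\Lambda$, with $d(x):=m\in(\mathbb N\cup\{\infty\})^k$, such that for every $n\in\mathbb N^k$ with $n\le d(x)$ and every finite exhaustive set $E\subseteq x(n)\Lambda$ (every $\mu\in x(n)\Lambda$ has $\Lambda^{\min}(\lambda,\mu)\ne\emptyset$ for some $\lambda\in E$) there is $\lambda\in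 E$ with $n+d(\lambda)\le d(x)$ and $x(n,n+d(\lambda))=\lambda$. For $\mu\in\Lambda$ and finite $F\subseteq s(\mu)\Lambda$ put $Z(\mu)=\{x\in\partial\Lambda: d(\mu)\le d(x),\ x(0,d(\mu))=\mu\}$ and $Z(\mu\setminus F)=Z(\mu)\setminus\bigcup_{\nu\in F}Z(\mu\nu)$, and give $\partial\Lambda$ the topology generated by the sets $Z(\mu\setminus F)$. Let $\mathcal G_\Lambda$ be the boundary path groupoid: its unit space is $\mathcal G_\Lambda^0=\partial\Lambda$ and its arrows are the triples $(x,p-q,y)$ with $x,y\in\partial\Lambda$, $p,q\in\mathbb N^k$, $p\le d(x)$, $q\le d(y)$ and $\sigma^p(x)=\sigma^q(y)$, where $\sigma$ is the shift. Let $\mathrm{Orb}_x$ be the orbit of $x\in\partial\Lambda$, and give the orbit space $\mathcal G_\Lambda^0/\mathcal G_\Lambda$ the quotient topology. Then $\mathcal G_\Lambda^0/\mathcal G_\Lambda$ is $T_0$ if and only if for each $x\in\partial\Lambda$ there exist $\mu\in\Lambda$ and a finite $F\subseteq s(\mu)\Lambda$ such that $Z(\mu\setminus F)\cap\mathrm{Orb}_x=\{x\}$.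 This is also equivalent to: every orbit is discrete in the relative topology of $\partial\Lambda$. -/

import Mathlib

open CategoryTheory

universe v u

/-- A higher-rank graph of rank `k` (a `k`-graph): a small category with a degree functor to the
monoid `ℕ^k` that has the unique factorisation property.

Convention: a path `μ` with range `a` and source `b` is written `μ : a ⟶ b`, and the composite
path `μν` (defined when the source of `μ` is the range of `ν`) is written `μ ≫ ν`. -/
structure HigherRankGraph (k : ℕ) where
  /-- The vertices. -/
  Obj : Type u
  /-- The paths and their composition. -/
  [cat : Category.{v} Obj]
  /-- The degree of a path. -/
  deg : ∀ {a b : Obj}, (a ⟶ b) → (Fin k → ℕ)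
  deg_id : ∀ a : Obj, deg (𝟙 a) = 0
  deg_comp : ∀ {a b c : Obj} (μ : a ⟶ b) (ν : b ⟶ c), deg (μ ≫ ν) = deg μ + deg ν
  factorisation : ∀ {a c : Obj} (l : a ⟶ c) (m n : Fin k → ℕ), deg l = m + n →
    ∃! t : Σ b : Obj, (a ⟶ b) × (b ⟶ c), t.2.1 ≫ t.2.2 = l ∧ deg t.2.1 = m ∧ deg t.2.2 = n

namespace HigherRankGraph

attribute [instance] HigherRankGraph.cat

/-- `vΛ`: the paths with range `v` (bundled with their source). -/
abbrev Out {k : ℕ} (Λ : HigherRankGraph.{v, u} k) (a : Λ.Obj) : Type (max u v) :=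
  Σ b : Λ.Obj, (a ⟶ b)

/-- The set of all paths of `Λ` (bundled with range and source). -/
abbrev Mor {k : ℕ} (Λ : HigherRankGraph.{v, u} k) : Type (max u v) :=
  Σ a : Λ.Obj, Λ.Out a

/-- `Λ` is countable: it has countably many paths (hence also countably many vertices). -/
def IsCountable {k : ℕ} (Λ : HigherRankGraph.{v, u} k) : Prop :=
  Countable Λ.Mor

/-- `Λ^min(μ, ν)`: the pairs `(α, β)` with `μα = νβ` and `d(μα) = d(μ) ∨ d(ν)`. (It is empty by
definition if `μ` and `ν` have different ranges.) -/
def minExt {k : ℕ} (Λ : HigherRankGraph.{v, u} k) {a : Λ.Obj} (μ ν : Λ.Out a) :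
    Set (Σ c : Λ.Obj, (μ.1 ⟶ c) × (ν.1 ⟶ c)) :=
  {t | μ.2 ≫ t.2.1 = ν.2 ≫ t.2.2 ∧ Λ.deg (μ.2 ≫ t.2.1) = Λ.deg μ.2 ⊔ Λ.deg ν.2}

/-- `Λ` is finitely aligned: each `Λ^min(μ, ν)` is finite. -/
def FinitelyAligned {k : ℕ} (Λ : HigherRankGraph.{v, u} k) : Prop :=
  ∀ (a : Λ.Obj) (μ ν : Λ.Out a), (Λ.minExt μ ν).Finite

/-- A set `E ⊆ vΛ` is exhaustive if each path in `vΛ` has a common extension with a path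
in `E`. -/
def Exhaustive {k : ℕ} (Λ : HigherRankGraph.{v, u} k) {a : Λ.Obj} (E : Set (Λ.Out a)) : Prop :=
  ∀ μ : Λ.Out a, ∃ l ∈ E, (Λ.minExt l μ).Nonempty

/-- The objects of the category `Ω_{k,m}`: the `n ∈ ℕ^k` with `n ≤ m`, where `m ∈ (ℕ ∪ {∞})^k`.
With its order, regarded as a category, it has exactly one arrow `p ⟶ q` whenever `p ≤ q`
(with range `p` and source `q` in the convention above), so that it is `Ω_{k,m}`. -/
abbrev Box {k : ℕ} (m : Fin k → ℕ∞) : Type :=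
  {n : Fin k → ℕ // ∀ i, (n i : ℕ∞) ≤ m i}

/-- A path, finite or infinite, in `Λ`: a degree-preserving functor `Ω_{k,m} ⥤ Λ` with
`m ∈ (ℕ ∪ {∞})^k`, where `m` is the degree of the path, and the arrow `p ⟶ q` of `Ω_{k,m}` has
degree `q - p`. -/
structure Path {k : ℕ} (Λ : HigherRankGraph.{v, u} k) where
  degree : Fin k → ℕ∞
  functor : Box degree ⥤ Λ.Obj
  add_deg_map : ∀ {p q : Box degree} (f : p ⟶ q), p.1 + Λ.deg (functor.map f) = q.1

namespace Path

variable {k : ℕ} {Λ : HigherRankGraph.{v, u} k}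

/-- `x(n)`, for `n ≤ d(x)`. -/
def vertex (x : Λ.Path) (n : Box x.degree) : Λ.Obj :=
  x.functor.obj n

/-- `x(p, q)` as a path with range `x(p)`, for `p ≤ q ≤ d(x)`. -/
def segment (x : Λ.Path) (p q : Box x.degree) (h : p ≤ q) : Λ.Out (x.vertex p) :=
  ⟨x.vertex q, x.functor.map (homOfLE h)⟩

/-- The inclusion `n ↦ p + n` of `Ω_{k,m-p}` into `Ω_{k,m}`. -/
def boxAdd {m : Fin k → ℕ∞} (p : Box m) (n : Box (fun i => m i - (p.1 i : ℕ∞))) : Box m :=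
  ⟨p.1 + n.1, fun i => by
    have h := add_le_add_right (n.2 i) (p.1 i : ℕ∞)
    rw [add_tsub_cancel_of_le (p.2 i)] at h
    simpa using h⟩

theorem boxAdd_mono {m : Fin k → ℕ∞} (p : Box m) : Monotone (boxAdd p) :=
  fun _ _ h i => Nat.add_le_add_left (h i) (p.1 i)

/-- The shift `σ^p(x)`, for `p ≤ d(x)`: the path of degree `d(x) - p` with
`σ^p(x)(n, n') = x(p + n, p + n')`. -/
def shift (x : Λ.Path) (p : Box x.degree) : Λ.Path where
  degree := fun i => x.degree i - (p.1 i : ℕ∞)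
  functor := (boxAdd_mono p).functor ⋙ x.functor
  add_deg_map := by
    intro n n' f
    have h := x.add_deg_map ((boxAdd_mono p).functor.map f)
    have h' : p.1 + (n.1 + Λ.deg (x.functor.map ((boxAdd_mono p).functor.map f)))
        = p.1 + n'.1 := by
      rw [← add_assoc]; exact h
    exact add_left_cancel h'

theorem shift_congr {x y : Λ.Path} (h : x = y) (p : Box x.degree) (q : Box y.degree)
    (hpq : p.1 = q.1) : x.shift p = y.shift q := by
  subst h
  rw [Subtype.ext hpq]

theorem ext_aux {m m' : Fin k → ℕ∞} (hm : m = m') (F : Box m ⥤ Λ.Obj) (G : Box m' ⥤ Λ.Obj)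
    (H : ∀ (p q : Box m) (p' q' : Box m') (f : p ⟶ q) (f' : p' ⟶ q'), p.1 = p'.1 → q.1 = q'.1 →
      F.obj p = G.obj p' ∧ F.map f ≍ G.map f') : F ≍ G := by
  subst hm
  exact heq_of_eq (Functor.hext (fun p => (H p p p p (𝟙 p) (𝟙 p) rfl rfl).1)
    (fun p q f => (H p q p q f f rfl rfl).2))

theorem shift_shift (x : Λ.Path) (p : Box x.degree) (n : Box (x.shift p).degree) :
    (x.shift p).shift n = x.shift (boxAdd p n) := by
  have hd : (fun i => (x.degree i - (p.1 i : ℕ∞)) - (n.1 i : ℕ∞))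
      = fun i => x.degree i - ((boxAdd p n).1 i : ℕ∞) := by
    funext i
    simp [boxAdd, tsub_add_eq_tsub_tsub]
  have key : ∀ (a : Box fun i => (x.degree i - (p.1 i : ℕ∞)) - (n.1 i : ℕ∞))
      (a' : Box fun i => x.degree i - ((boxAdd p n).1 i : ℕ∞)), a.1 = a'.1 →
      boxAdd p (boxAdd n a) = boxAdd (boxAdd p n) a' := by
    intro a a' h
    apply Subtype.ext
    simp [boxAdd, h, add_assoc]
  have map_heq : ∀ {b c b' c' : Box x.degree} (f : b ⟶ c) (f' : b' ⟶ c'), b = b' → c = c' →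
      x.functor.map f ≍ x.functor.map f' := by
    intro b c b' c' f f' hb hc
    subst hb hc
    exact heq_of_eq (congrArg _ (Subsingleton.elim _ _))
  have hF := ext_aux (Λ := Λ) hd ((x.shift p).shift n).functor (x.shift (boxAdd p n)).functor
    (fun a b a' b' f f' ha hb =>
      ⟨congrArg x.functor.obj (key a a' ha), map_heq _ _ (key a a' ha) (key b b' hb)⟩)
  have mk_eq : ∀ (z w : Λ.Path), z.degree = w.degree → z.functor ≍ w.functor → z = w := by
    rintro ⟨d, F, hF⟩ ⟨d', G, hG⟩ h h'
    cases h
    cases h'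
    rfl
  exact mk_eq _ _ hd hF

/-- `x` is a boundary path: for each `n ≤ d(x)` and each finite exhaustive `E ⊆ x(n)Λ` there is a
`λ ∈ E` with `n + d(λ) ≤ d(x)` and `x(n, n + d(λ)) = λ`. -/
def IsBoundary (x : Λ.Path) : Prop :=
  ∀ (n : Box x.degree) (E : Finset (Λ.Out (x.vertex n))),
    Λ.Exhaustive (E : Set (Λ.Out (x.vertex n))) →
      ∃ l ∈ E, ∃ (q : Box x.degree) (h : n ≤ q), q.1 = n.1 + Λ.deg l.2 ∧ x.segment n q h = l

end Path

/-- The boundary path space `∂Λ`. -/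
def BoundaryPath {k : ℕ} (Λ : HigherRankGraph.{v, u} k) : Type (max u v) :=
  {x : Λ.Path // x.IsBoundary}

variable {k : ℕ} {Λ : HigherRankGraph.{v, u} k}

/-- The cylinder set `Z(μ) = {μx ∈ ∂Λ}`: the boundary paths `y` with `d(μ) ≤ d(y)` and
`y(0, d(μ)) = μ` (the equality includes `y(0) = r(μ)`). -/
def cylinder {a b : Λ.Obj} (μ : a ⟶ b) : Set Λ.BoundaryPath :=
  {y | ∃ (p q : Box y.1.degree) (h : p ≤ q), p.1 = 0 ∧ q.1 = Λ.deg μ ∧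
    (⟨y.1.vertex p, y.1.segment p q h⟩ : Λ.Mor) = ⟨a, b, μ⟩}

/-- `Z(μ \ F) = Z(μ) \ ⋃_{ν ∈ F} Z(μν)`, for a finite set `F` of paths with range `s(μ)`. -/
def cylinderDiff {a b : Λ.Obj} (μ : a ⟶ b) (F : Finset (Λ.Out b)) : Set Λ.BoundaryPath :=
  cylinder μ \ ⋃ ν ∈ F, cylinder (μ ≫ ν.2)

/-- The topology of `∂Λ`, generated by the sets `Z(μ \ F)`. -/
instance BoundaryPath.topologicalSpace : TopologicalSpace Λ.BoundaryPath :=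
  TopologicalSpace.generateFrom
    {U | ∃ (a b : Λ.Obj) (μ : a ⟶ b) (F : Finset (Λ.Out b)), U = cylinderDiff μ F}

/-- `m ∈ ℤ^k` is a lag from `x` to `y` if `m = p - q` for some `p ≤ d(x)` and `q ≤ d(y)` with
`σ^p(x) = σ^q(y)`. -/
def IsLag (x y : Λ.BoundaryPath) (m : Fin k → ℤ) : Prop :=
  ∃ (p : Box x.1.degree) (q : Box y.1.degree),
    (∀ i, m i = (p.1 i : ℤ) - (q.1 i : ℤ)) ∧ x.1.shift p = y.1.shift q

theorem IsLag.refl (x : Λ.BoundaryPath) : IsLag x x 0 :=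
  ⟨⟨0, fun i => by simp⟩, ⟨0, fun i => by simp⟩, fun i => by simp, rfl⟩

theorem IsLag.symm {x y : Λ.BoundaryPath} {m : Fin k → ℤ} (h : IsLag x y m) :
    IsLag y x (-m) := by
  obtain ⟨p, q, hm, h⟩ := h
  exact ⟨q, p, fun i => by simp [hm i], h.symm⟩

theorem IsLag.trans {x y z : Λ.BoundaryPath} {m n : Fin k → ℤ} (h : IsLag x y m)
    (h' : IsLag y z n) : IsLag x z (m + n) := by
  obtain ⟨p, q, hm, hs⟩ := h
  obtain ⟨p', q', hn, hs'⟩ := h'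
  have hsup : ∀ i, (((q.1 ⊔ p'.1) i : ℕ) : ℕ∞) ≤ y.1.degree i := by
    intro i
    rcases le_total (q.1 i) (p'.1 i) with hi | hi
    · simpa [hi] using p'.2 i
    · simpa [hi] using q.2 i
  have hdiff : ∀ (r : Box y.1.degree) (i : Fin k),
      ((((q.1 ⊔ p'.1) - r.1) i : ℕ) : ℕ∞) ≤ y.1.degree i - (r.1 i : ℕ∞) := by
    intro r i
    have := tsub_le_tsub_right (hsup i) (r.1 i : ℕ∞)
    simpa using this
  let a : Box (y.1.shift q).degree := ⟨(q.1 ⊔ p'.1) - q.1, hdiff q⟩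
  let b : Box (y.1.shift p').degree := ⟨(q.1 ⊔ p'.1) - p'.1, hdiff p'⟩
  let a' : Box (x.1.shift p).degree := ⟨a.1, by rw [hs]; exact a.2⟩
  let b' : Box (z.1.shift q').degree := ⟨b.1, by rw [← hs']; exact b.2⟩
  refine ⟨Path.boxAdd p a', Path.boxAdd q' b', fun i => ?_, ?_⟩
  · have h1 : q.1 i ≤ max (q.1 i) (p'.1 i) := le_max_left _ _
    have h2 : p'.1 i ≤ max (q.1 i) (p'.1 i) := le_max_right _ _
    have e1 := hm i
    have e2 := hn i
    simp only [Pi.add_apply, Path.boxAdd, a', b', a, b, Pi.sub_apply, Pi.sup_apply]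
    push_cast [Nat.cast_sub h1, Nat.cast_sub h2]
    linarith
  · rw [← Path.shift_shift, ← Path.shift_shift, Path.shift_congr hs a' a rfl,
      ← Path.shift_congr hs' b b' rfl, Path.shift_shift, Path.shift_shift]
    apply Path.shift_congr rfl
    have h1 : q.1 ≤ q.1 ⊔ p'.1 := le_sup_left
    have h2 : p'.1 ≤ q.1 ⊔ p'.1 := le_sup_right
    change q.1 + ((q.1 ⊔ p'.1) - q.1) = p'.1 + ((q.1 ⊔ p'.1) - p'.1)
    rw [add_tsub_cancel_of_le h1, add_tsub_cancel_of_le h2]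

/-- The boundary path groupoid of `Λ`. Its unit space is `∂Λ`, and its arrows are the triples
`(x, p - q, y)` with `p ≤ d(x)`, `q ≤ d(y)` and `σ^p(x) = σ^q(y)`, with range `x` and source `y`,
`(x, m, y)(y, n, z) = (x, m + n, z)` and `(x, m, y)⁻¹ = (y, -m, x)`. -/
instance BoundaryPath.groupoid : Groupoid Λ.BoundaryPath where
  Hom x y := {m : Fin k → ℤ // IsLag x y m}
  id x := ⟨0, IsLag.refl x⟩
  comp f g := ⟨f.1 + g.1, f.2.trans g.2⟩
  id_comp f := Subtype.ext (zero_add f.1)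
  comp_id f := Subtype.ext (add_zero f.1)
  assoc f g h := Subtype.ext (add_assoc f.1 g.1 h.1)
  inv f := ⟨-f.1, f.2.symm⟩
  inv_comp f := Subtype.ext (neg_add_cancel f.1)
  comp_inv f := Subtype.ext (add_neg_cancel f.1)

end HigherRankGraph

/-- The orbit equivalence relation on the unit space of a groupoid: `u ∼ v` if there is an
arrow from `u` to `v`. -/
def orbitSetoid (G : Type u) [Groupoid.{v} G] : Setoid G where
  r x y := Nonempty (x ⟶ y)
  iseqv :=
    { refl := fun x => ⟨𝟙 x⟩
      symm := fun ⟨f⟩ => ⟨Groupoid.inv f⟩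
      trans := fun ⟨f⟩ ⟨g⟩ => ⟨f ≫ g⟩ }

/-- The orbit of a unit of a groupoid. -/
def groupoidOrbit {G : Type u} [Groupoid.{v} G] (x : G) : Set G :=
  {y | Nonempty (x ⟶ y)}

/-- The orbit space of a groupoid. If the unit space has a topology, the orbit space has the
quotient topology. -/
abbrev OrbitSpace (G : Type u) [Groupoid.{v} G] : Type u :=
  Quotient (orbitSetoid G)

/-! The core is a Baire category argument for an equivalence relation on a second countable locally
compact Hausdorff space whose classes are moved around by countably many continuous, locally
injective maps (`t0Space_quotient_iff_isolated`). Saturations of open sets are then open and classes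
are countable. If a class has one isolated point, the maps make all its points isolated. If it has
none, its closure is a Baire space in which the complement of each point of the class is dense and
open, and so is the saturation of each basic open set meeting the class. A point in all these sets
lies outside the class but cannot be separated from it in the quotient, so the quotient is not T0.
Conversely, two classes with inseparable images meet the same open sets, and an open set isolating a
point of one class forces them to coincide.

To apply this to `∂Λ`, a boundary path is replaced by its set of initial segments. The sets that
occur are the nonempty, hereditary, directed ones that respect finite exhaustive sets
(`IsBoundaryFilter`). Their indicator functions embed `∂Λ` in a product of copies of `{0,1}`, with
locally closed range because `Λ` is finitely aligned; this gives the topological hypotheses. The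
maps are `μz ↦ νz`, one for each pair of paths with a common source, extended by the identity off
`Z(μ)`. Finally, the sets `Z(μ \ F)` form a basis, so isolating open sets may be taken of this form.
-/

/-! ### Baire category and T0 quotients -/

open Set TopologicalSpace in
theorem t0Space_quotient_iff_isolated {X : Type u} {ι : Type v} [TopologicalSpace X] [T2Space X]
    [SecondCountableTopology X] [LocallyCompactSpace X] [Countable ι] (s : Setoid X)
    (T : ι → X → X) (hT : ∀ i, Continuous (T i)) (hr : ∀ i x, s x (T i x))
    (hex : ∀ x y, s x y → ∃ i, T i x = y ∧ ∃ U, IsOpen U ∧ x ∈ U ∧ InjOn (T i) U) :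
    T0Space (Quotient s) ↔ ∀ x, ∃ U, IsOpen U ∧ U ∩ {y | s x y} = {x} := by
  have hsat : ∀ U : Set X, IsOpen U → IsOpen {x | ∃ y ∈ U, s x y} := by
    intro U hU
    have : {x | ∃ y ∈ U, s x y} = ⋃ i, T i ⁻¹' U := by
      ext x
      simp only [mem_ofPred_eq, mem_iUnion, mem_preimage]
      constructor
      · rintro ⟨y, hy, hxy⟩
        obtain ⟨i, rfl, -⟩ := hex x y hxy
        exact ⟨i, hy⟩
      · rintro ⟨i, hi⟩
        exact ⟨_, hi, hr i x⟩
    rw [this]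
    exact isOpen_iUnion fun i => hU.preimage (hT i)
  constructor
  · intro h0 x
    set O : Set X := {y | s x y} with hO
    have hxO : x ∈ O := s.refl x
    have hcount : O.Countable := by
      refine (countable_range fun i => T i x).mono ?_
      intro y hy
      obtain ⟨i, hi, -⟩ := hex x y hy
      exact ⟨i, hi⟩
    suffices ∃ y ∈ O, ∃ U, IsOpen U ∧ U ∩ O = {y} by
      obtain ⟨y, hy, U, hU, hUO⟩ := this
      obtain ⟨i, hi, V, hV, hxV, hinj⟩ := hex x y hy
      have hyU : y ∈ U ∩ O := by rw [hUO]; rfl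
      -- `T i` sends every point of the class in this neighbourhood to `y`, and it is injective on
      -- `V`, so only `x` is left.
      refine ⟨V ∩ T i ⁻¹' U, hV.inter (hU.preimage (hT i)), ?_⟩
      apply Subset.antisymm
      · rintro z ⟨⟨hzV, hzU⟩, hz⟩
        have h1 : T i z ∈ U ∩ O := ⟨hzU, s.trans hz (hr i z)⟩
        rw [hUO, mem_singleton_iff, ← hi] at h1
        exact hinj hzV hxV h1
      · rintro z rfl
        exact ⟨⟨hxV, by rw [mem_preimage, hi]; exact hyU.1⟩, hxO⟩
    by_contra! hno
    have : LocallyCompactSpace (closure O) := isClosed_closure.locallyCompactSpace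
    have hnot : ∀ y : O, Dense ({⟨y.1, subset_closure y.2⟩}ᶜ : Set (closure O)) := by
      intro y
      rw [dense_compl_singleton_iff_not_open]
      intro ho
      obtain ⟨U, hU, hUy⟩ := isOpen_induced_iff.1 ho
      refine hno y.1 y.2 U hU (Subset.antisymm ?_ ?_)
      · rintro z ⟨hzU, hzO⟩
        have : (⟨z, subset_closure hzO⟩ : closure O) ∈ Subtype.val ⁻¹' U := hzU
        rw [hUy] at this
        exact congrArg Subtype.val this
      · rintro z rfl
        refine ⟨?_, y.2⟩
        have : (⟨y.1, subset_closure y.2⟩ : closure O) ∈ Subtype.val ⁻¹' U := by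
          rw [hUy]; rfl
        exact this
    have : Countable O := hcount.to_subtype
    let B := {b : Set X // b ∈ countableBasis X ∧ (b ∩ O).Nonempty}
    have : Countable B :=
      ((countable_countableBasis X).mono fun b (hb : _ ∧ (b ∩ O).Nonempty) => hb.1).to_subtype
    -- Countably many dense open subsets of `closure O`. A point of all of them avoids `O`, while
    -- its class meets every basic open set that meets `O`.
    let W : B ⊕ O → Set (closure O) := Sum.elim
      (fun b => Subtype.val ⁻¹' {x | ∃ y ∈ b.1, s x y})
      (fun y => {⟨y.1, subset_closure y.2⟩}ᶜ)
    have hWo : ∀ j, IsOpen (W j) := by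
      rintro (b | y)
      · exact (hsat b.1 (isOpen_of_mem_countableBasis b.2.1)).preimage continuous_subtype_val
      · exact isOpen_compl_singleton
    have hWd : ∀ j, Dense (W j) := by
      rintro (b | y)
      · obtain ⟨w, hwb, hwO⟩ := b.2.2
        have hd : Dense (Subtype.val ⁻¹' O : Set (closure O)) := by
          rw [Subtype.dense_iff]
          intro z hz
          rwa [Subtype.image_preimage_coe, inter_eq_right.2 subset_closure]
        exact hd.mono fun z hz => ⟨w, hwb, s.trans (s.symm hz) hwO⟩
      · exact hnot y
    have : Nonempty (closure O) := ⟨⟨x, subset_closure hxO⟩⟩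
    obtain ⟨z, hz⟩ := (dense_iInter_of_isOpen hWo hWd).nonempty
    rw [mem_iInter] at hz
    have hzO : z.1 ∉ O := fun h => hz (Sum.inr ⟨z.1, h⟩) rfl
    have hins : Inseparable (Quotient.mk s x) (Quotient.mk s z.1) := by
      rw [inseparable_iff_forall_isOpen]
      intro V hV
      have hV' : IsOpen (Quotient.mk s ⁻¹' V) := hV.preimage continuous_quotient_mk'
      constructor
      · intro hx
        obtain ⟨b, hb, hxb, hbV⟩ := (isBasis_countableBasis X).exists_subset_of_mem_open
          (show x ∈ Quotient.mk s ⁻¹' V from hx) hV'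
        obtain ⟨y, hyb, hy⟩ := hz (Sum.inl ⟨b, hb, x, hxb, hxO⟩)
        have : Quotient.mk s z.1 = Quotient.mk s y := Quotient.sound hy
        rw [this]
        exact hbV hyb
      · intro hzV
        obtain ⟨y, hyV, hy⟩ := mem_closure_iff.1 z.2 _ hV' hzV
        have : Quotient.mk s x = Quotient.mk s y := Quotient.sound hy
        rw [this]
        exact hyV
    exact hzO (Quotient.exact hins.eq)
  · intro h
    refine ⟨fun p q => ?_⟩
    induction p using Quotient.inductionOn with | _ x
    induction q using Quotient.inductionOn with | _ y
    intro hins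
    rw [inseparable_iff_forall_isOpen] at hins
    obtain ⟨U, hU, hUx⟩ := h x
    have key : ∀ V : Set X, IsOpen V → ((∃ z ∈ V, s x z) ↔ ∃ z ∈ V, s y z) := by
      intro V hV
      have hpre : Quotient.mk s ⁻¹' (Quotient.mk s '' V) = {x | ∃ y ∈ V, s x y} := by
        ext a
        constructor
        · rintro ⟨b, hb, hab⟩
          exact ⟨b, hb, s.symm (Quotient.exact hab)⟩
        · rintro ⟨b, hb, hab⟩
          exact ⟨b, hb, Quotient.sound (s.symm hab)⟩
      have ho : IsOpen (Quotient.mk s '' V) := by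
        rw [← isQuotientMap_quotient_mk'.isOpen_preimage]
        change IsOpen (Quotient.mk s ⁻¹' _)
        rw [hpre]
        exact hsat V hV
      have := hins _ ho
      change x ∈ Quotient.mk s ⁻¹' (Quotient.mk s '' V) ↔
        y ∈ Quotient.mk s ⁻¹' (Quotient.mk s '' V) at this
      rwa [hpre] at this
    have hxU : x ∈ U ∩ {y | s x y} := by rw [hUx]; rfl
    obtain ⟨z, hzU, hz⟩ := (key U hU).1 ⟨x, hxU.1, s.refl x⟩
    by_cases hzx : z = x
    · subst hzx
      exact Quotient.sound (s.symm hz)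
    -- The class of `y` meets the open set `U \ {x}`, hence so does the class of `x`, against the
    -- choice of `U`.
    · obtain ⟨w, ⟨hwU, hwx⟩, hw⟩ := (key (U \ {x}) (hU.sdiff isClosed_singleton)).2
        ⟨z, ⟨hzU, hzx⟩, hz⟩
      have : w ∈ U ∩ {y | s x y} := ⟨hwU, hw⟩
      rw [hUx] at this
      exact absurd this hwx

namespace HigherRankGraph

/-! ### Initial segments and minimal common extensions -/

section Morphisms

variable {k : ℕ} {Λ : HigherRankGraph.{v, u} k}

/-- The composite path `le`. -/
def Mor.append (l : Λ.Mor) (e : Λ.Out l.2.1) : Λ.Mor :=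
  ⟨l.1, e.1, l.2.2 ≫ e.2⟩

/-- The degree of a path bundled with its range and source. -/
def Mor.degree (l : Λ.Mor) : Fin k → ℕ :=
  Λ.deg l.2.2

/-- `l` is an initial segment of `m`. -/
def Mor.IsPrefix (l m : Λ.Mor) : Prop :=
  ∃ e : Λ.Out l.2.1, m = l.append e

/-- The minimal common extensions of `l` and `m`. -/
def Mor.minCommonExt (l m : Λ.Mor) : Set Λ.Mor :=
  {r | l.IsPrefix r ∧ m.IsPrefix r ∧ r.degree = l.degree ⊔ m.degree}

namespace Mor

theorem degree_append (l : Λ.Mor) (e : Λ.Out l.2.1) :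
    (l.append e).degree = l.degree + Λ.deg e.2 :=
  Λ.deg_comp _ _

/-- Unique factorisation as a cancellation law. The tails have different types until the heads are
identified, hence the heterogeneous equality. -/
theorem append_eq_append {a : Λ.Obj} {e e' : Λ.Out a} {f : Λ.Out e.1} {f' : Λ.Out e'.1}
    (h : append ⟨a, e⟩ f = append ⟨a, e'⟩ f') (hd : Λ.deg e.2 = Λ.deg e'.2) :
    e = e' ∧ Λ.deg f.2 = Λ.deg f'.2 ∧ f ≍ f' := by
  obtain ⟨b, μ⟩ := e
  obtain ⟨b', μ'⟩ := e'
  obtain ⟨c, α⟩ := f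
  obtain ⟨c', α'⟩ := f'
  simp only [append, Sigma.mk.injEq, true_and, heq_eq_eq] at h
  obtain ⟨rfl, h⟩ := h
  have h := eq_of_heq h
  have hd' : Λ.deg α = Λ.deg α' := by
    have := congrArg Λ.deg h
    rw [Λ.deg_comp, Λ.deg_comp] at this
    simp only at hd
    rw [hd] at this
    exact add_left_cancel this
  have := (Λ.factorisation (μ ≫ α) (Λ.deg μ) (Λ.deg α) (Λ.deg_comp _ _)).unique
    (y₁ := ⟨b, μ, α⟩) (y₂ := ⟨b', μ', α'⟩) ⟨rfl, rfl, rfl⟩ ⟨h.symm, hd.symm, hd'.symm⟩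
  cases this
  exact ⟨rfl, rfl, HEq.rfl⟩

theorem append_injective (l : Λ.Mor) : Function.Injective l.append := by
  intro f f' h
  obtain ⟨a, e⟩ := l
  exact eq_of_heq (append_eq_append h rfl).2.2

theorem IsPrefix.refl (l : Λ.Mor) : l.IsPrefix l :=
  ⟨⟨l.2.1, 𝟙 _⟩, by simp [append]⟩

theorem isPrefix_append (l : Λ.Mor) (e : Λ.Out l.2.1) : l.IsPrefix (l.append e) :=
  ⟨e, rfl⟩

theorem append_append (l : Λ.Mor) (e : Λ.Out l.2.1) (f : Λ.Out e.1) :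
    append (l.append e) f = l.append ⟨f.1, e.2 ≫ f.2⟩ := by
  simp [append]

theorem IsPrefix.trans {l m n : Λ.Mor} (h : l.IsPrefix m) (h' : m.IsPrefix n) :
    l.IsPrefix n := by
  obtain ⟨e, rfl⟩ := h
  obtain ⟨f, rfl⟩ := h'
  exact ⟨_, append_append l e f⟩

theorem IsPrefix.range_eq {l m : Λ.Mor} (h : l.IsPrefix m) : l.1 = m.1 := by
  obtain ⟨e, rfl⟩ := h
  rfl

theorem IsPrefix.degree_le {l m : Λ.Mor} (h : l.IsPrefix m) : l.degree ≤ m.degree := by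
  obtain ⟨e, rfl⟩ := h
  rw [degree_append]
  exact le_self_add

theorem IsPrefix.exists_hom {l m : Λ.Mor} (h : l.IsPrefix m) :
    ∃ f : l.2.1 ⟶ m.2.1, m = l.append ⟨m.2.1, f⟩ := by
  obtain ⟨e, rfl⟩ := h
  exact ⟨e.2, rfl⟩

theorem IsPrefix.eq_of_degree_eq {l m n : Λ.Mor} (hl : l.IsPrefix n) (hm : m.IsPrefix n)
    (hd : l.degree = m.degree) : l = m := by
  obtain ⟨a, e⟩ := l
  obtain ⟨a', e'⟩ := m
  obtain ⟨f, rfl⟩ := hl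
  obtain ⟨f', h⟩ := hm
  obtain rfl : a = a' := congrArg Sigma.fst h
  rw [(append_eq_append h hd).1]

theorem exists_isPrefix_degree_eq (l : Λ.Mor) {n : Fin k → ℕ} (h : n ≤ l.degree) :
    ∃ m : Λ.Mor, m.IsPrefix l ∧ m.degree = n := by
  obtain ⟨a, c, μ⟩ := l
  obtain ⟨⟨b, α, β⟩, ⟨h1, h2, -⟩, -⟩ :=
    Λ.factorisation μ n (Λ.deg μ - n) (add_tsub_cancel_of_le h).symm
  exact ⟨⟨a, b, α⟩, ⟨⟨c, β⟩, by rw [← h1]; rfl⟩, h2⟩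

theorem IsPrefix.of_degree_le {l m n : Λ.Mor} (hl : l.IsPrefix n) (hm : m.IsPrefix n)
    (hd : l.degree ≤ m.degree) : l.IsPrefix m := by
  obtain ⟨l', h1, h2⟩ := m.exists_isPrefix_degree_eq hd
  rwa [hl.eq_of_degree_eq (h1.trans hm) h2.symm]

/-- Cut `n` at degree `d(l) ∨ d(m)`; initial segments of a single path are ordered by their degrees.
-/
theorem exists_mem_minCommonExt {l m n : Λ.Mor} (hl : l.IsPrefix n) (hm : m.IsPrefix n) :
    ∃ r ∈ l.minCommonExt m, r.IsPrefix n := by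
  obtain ⟨r, h1, h2⟩ := n.exists_isPrefix_degree_eq (sup_le hl.degree_le hm.degree_le)
  exact ⟨r, ⟨hl.of_degree_le h1 (h2 ▸ le_sup_left), hm.of_degree_le h1 (h2 ▸ le_sup_right), h2⟩,
    h1⟩

theorem minCommonExt_eq_image {a : Λ.Obj} (e f : Λ.Out a) :
    minCommonExt ⟨a, e⟩ ⟨a, f⟩ =
      (fun t => (⟨a, t.1, e.2 ≫ t.2.1⟩ : Λ.Mor)) '' Λ.minExt e f := by
  ext r
  constructor
  · rintro ⟨⟨⟨c, α⟩, rfl⟩, ⟨⟨c', β⟩, h⟩, hd⟩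
    simp only [append, Sigma.mk.injEq, true_and, heq_eq_eq] at h
    obtain ⟨rfl, h⟩ := h
    exact ⟨⟨c, α, β⟩, ⟨eq_of_heq h, hd⟩, rfl⟩
  · rintro ⟨⟨c, α, β⟩, ⟨h1, h2⟩, rfl⟩
    exact ⟨⟨⟨c, α⟩, rfl⟩, ⟨⟨c, β⟩, by simp only [append]; rw [← h1]⟩, h2⟩

theorem finite_minCommonExt (halign : Λ.FinitelyAligned) (l m : Λ.Mor) :
    (l.minCommonExt m).Finite := by
  obtain ⟨a, e⟩ := l
  obtain ⟨a', f⟩ := m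
  by_cases h : a = a'
  · subst h
    rw [minCommonExt_eq_image]
    exact (halign a e f).image _
  · convert Set.finite_empty
    ext r
    simp only [Set.mem_empty_iff_false, iff_false]
    rintro ⟨h1, h2, -⟩
    exact h (h1.range_eq.trans h2.range_eq.symm)

/-- The paths that extend `l` to a minimal common extension of `l` and `m`. -/
theorem finite_append_mem_minCommonExt (halign : Λ.FinitelyAligned) (l m : Λ.Mor) :
    {e | l.append e ∈ l.minCommonExt m}.Finite :=
  (finite_minCommonExt halign l m).preimage l.append_injective.injOn

end Mor

/-- Any common extension contains a minimal one, so minimality can be dropped from the test. -/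
theorem exhaustive_iff_exists_isPrefix {a : Λ.Obj} {E : Set (Λ.Out a)} :
    Λ.Exhaustive E ↔ ∀ μ : Λ.Out a, ∃ l ∈ E, ∃ r : Λ.Mor,
      Mor.IsPrefix ⟨a, l⟩ r ∧ Mor.IsPrefix ⟨a, μ⟩ r := by
  refine forall_congr' fun μ => exists_congr fun l => and_congr_right fun _ => ?_
  rw [← Set.image_nonempty (f := fun t => (⟨a, t.1, l.2 ≫ t.2.1⟩ : Λ.Mor)),
    ← Mor.minCommonExt_eq_image]
  constructor
  · rintro ⟨r, h1, h2, -⟩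
    exact ⟨r, h1, h2⟩
  · rintro ⟨r, h1, h2⟩
    obtain ⟨r', h, -⟩ := Mor.exists_mem_minCommonExt h1 h2
    exact ⟨r', h⟩

/-- The finite exhaustive set `Ext(τ; E)` at the source of `τ`. -/
theorem Exhaustive.exists_ext (halign : Λ.FinitelyAligned) {b : Λ.Obj} {E : Finset (Λ.Out b)}
    (hE : Λ.Exhaustive (E : Set (Λ.Out b))) (τ : Λ.Out b) :
    ∃ E' : Finset (Λ.Out τ.1), Λ.Exhaustive (E' : Set (Λ.Out τ.1)) ∧
      ∀ α ∈ E', ∃ e ∈ E, Mor.IsPrefix ⟨b, e⟩ (Mor.append ⟨b, τ⟩ α) := by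
  -- `E'` consists of the `α` for which `τα` is a minimal common extension of `τ` and some `e ∈ E`.
  have hfin : (⋃ e ∈ E, {α : Λ.Out τ.1 | Mor.append ⟨b, τ⟩ α ∈
      Mor.minCommonExt ⟨b, τ⟩ ⟨b, e⟩}).Finite :=
    E.finite_toSet.biUnion fun e _ => Mor.finite_append_mem_minCommonExt halign ⟨b, τ⟩ ⟨b, e⟩
  refine ⟨hfin.toFinset, ?_, ?_⟩
  · rw [exhaustive_iff_exists_isPrefix] at hE ⊢
    intro ρ
    -- Exhaustiveness of `E` is tested on `τρ`. The resulting common extension with `e` contains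
    -- some `τα` with `α ∈ E'`; cancelling `τ` yields a common extension of `α` and `ρ`.
    obtain ⟨e, he, r, h1, h2⟩ := hE ⟨ρ.1, τ.2 ≫ ρ.2⟩
    have hτ : Mor.IsPrefix ⟨b, τ⟩ (⟨b, ρ.1, τ.2 ≫ ρ.2⟩ : Λ.Mor) := ⟨ρ, rfl⟩
    obtain ⟨r', hr', h3⟩ := Mor.exists_mem_minCommonExt (hτ.trans h2) h1
    obtain ⟨α, rfl⟩ := hr'.1
    refine ⟨α, hfin.mem_toFinset.2 (Set.mem_biUnion he hr'), ?_⟩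
    obtain ⟨γ, rfl⟩ := h2
    obtain ⟨δ, h4⟩ := h3
    have h5 : (⟨_, ρ.2 ≫ γ.2⟩ : Λ.Out τ.1) = ⟨_, α.2 ≫ δ.2⟩ := by
      apply Mor.append_injective ⟨b, τ⟩
      rw [← Mor.append_append, ← Mor.append_append ⟨b, τ⟩ α δ]
      exact h4
    refine ⟨⟨τ.1, _, ρ.2 ≫ γ.2⟩, ⟨δ, ?_⟩, ⟨γ, rfl⟩⟩
    rw [h5]
    rfl
  · intro α hα
    simp only [Set.Finite.mem_toFinset, Set.mem_iUnion, exists_prop] at hα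
    obtain ⟨e, he, h⟩ := hα
    exact ⟨e, he, h.2.1⟩

end Morphisms

/-! ### Paths determined by their initial segments -/

namespace Path

variable {k : ℕ} {Λ : HigherRankGraph.{v, u} k}

/-- The smallest object of `Ω_{k,m}`. -/
def boxZero (m : Fin k → ℕ∞) : Box m :=
  ⟨0, fun i => by simp⟩

theorem boxZero_le {m : Fin k → ℕ∞} (n : Box m) : boxZero m ≤ n :=
  fun _ => Nat.zero_le _

/-- The initial segment `x(0, n)`. -/
def initial (x : Λ.Path) (n : Box x.degree) : Λ.Mor :=
  ⟨x.vertex (boxZero _), x.segment _ n (boxZero_le n)⟩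

/-- The set of initial segments of a path. -/
def initials (x : Λ.Path) : Set Λ.Mor :=
  Set.range x.initial

theorem degree_initial (x : Λ.Path) (n : Box x.degree) : (x.initial n).degree = n.1 := by
  have := x.add_deg_map (homOfLE (boxZero_le n))
  rwa [show (boxZero x.degree).1 = 0 from rfl, zero_add] at this

theorem initial_append_segment (x : Λ.Path) {p q : Box x.degree} (h : p ≤ q) :
    (x.initial p).append (x.segment p q h) = x.initial q := by
  exact congrArg (fun f => (⟨_, _, f⟩ : Λ.Mor))
    (x.functor.map_comp (homOfLE (boxZero_le p)) (homOfLE h)).symm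

theorem initial_isPrefix (x : Λ.Path) {p q : Box x.degree} (h : p ≤ q) :
    (x.initial p).IsPrefix (x.initial q) :=
  ⟨_, (x.initial_append_segment h).symm⟩

theorem eq_initial {x : Λ.Path} {l : Λ.Mor} (h : l ∈ x.initials) {n : Box x.degree}
    (hn : l.degree = n.1) : l = x.initial n := by
  obtain ⟨q, rfl⟩ := h
  rw [degree_initial] at hn
  rw [Subtype.ext hn]

/-- The degrees of the initial segments determine the degree of the path, and `x(0,q) =
x(0,p)x(p,q)` determines `x(p,q)` by cancellation. -/
theorem initials_injective : Function.Injective (initials (Λ := Λ)) := by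
  intro x y h
  have hsub : ∀ x y : Λ.Path, x.initials = y.initials → ∀ p : Box x.degree,
      ∃ q : Box y.degree, q.1 = p.1 := by
    intro x y h p
    have hp : x.initial p ∈ y.initials := h ▸ ⟨p, rfl⟩
    obtain ⟨q, hq⟩ := hp
    exact ⟨q, by rw [← degree_initial, hq, degree_initial]⟩
  have hle : ∀ x y : Λ.Path, x.initials = y.initials → ∀ i, x.degree i ≤ y.degree i := by
    intro x y h i
    -- The `i`-th coordinate, possibly infinite, is probed with the multiples of the `i`-th unit
    -- vector.
    refine ENat.forall_natCast_le_iff_le.1 fun a ha => ?_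
    obtain ⟨q, hq⟩ := hsub x y h ⟨Pi.single i a, fun j => by
      by_cases hj : j = i
      · subst hj; simpa using ha
      · simp [hj]⟩
    have := q.2 i
    rw [hq] at this
    simpa using this
  have hd : x.degree = y.degree :=
    funext fun i => le_antisymm (hle x y h i) (hle y x h.symm i)
  have hini : ∀ (p : Box x.degree) (p' : Box y.degree), p.1 = p'.1 →
      x.initial p = y.initial p' := fun p p' hp =>
    eq_initial (h ▸ ⟨p, rfl⟩) ((degree_initial _ _).trans hp)
  have hF : x.functor ≍ y.functor := by
    refine ext_aux hd _ _ fun p q p' q' f f' hp hq => ?_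
    have h2 := hini q q' hq
    rw [← x.initial_append_segment (leOfHom f), ← y.initial_append_segment (leOfHom f')] at h2
    have hfst : x.vertex p = y.vertex p' :=
      congrArg (fun l : Λ.Mor => l.2.1) (hini p p' hp)
    refine ⟨hfst, ?_⟩
    have : ∀ (a a' b b' : Λ.Obj) (μ : a ⟶ b) (μ' : a' ⟶ b') (e : Λ.Out b) (e' : Λ.Out b'),
        (⟨a, b, μ⟩ : Λ.Mor) = ⟨a', b', μ'⟩ →
        Mor.append ⟨a, b, μ⟩ e = Mor.append ⟨a', b', μ'⟩ e' → e.2 ≍ e'.2 := by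
      intro a a' b b' μ μ' e e' h h'
      cases h
      rw [Mor.append_injective _ h']
    exact this _ _ _ _ _ _ _ _ (hini p p' hp) h2
  obtain ⟨d, F, hx⟩ := x
  obtain ⟨d', G, hy⟩ := y
  cases hd
  cases hF
  rfl

end Path

/-! ### Boundary paths as filters of finite paths -/

section Filters

variable {k : ℕ} {Λ : HigherRankGraph.{v, u} k}

/-- The sets of paths that are the set of all initial segments of some boundary path. -/
structure IsBoundaryFilter (S : Set Λ.Mor) : Prop where
  nonempty : S.Nonempty
  of_isPrefix : ∀ {l m : Λ.Mor}, l.IsPrefix m → m ∈ S → l ∈ S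
  directed : ∀ {l m : Λ.Mor}, l ∈ S → m ∈ S → ∃ r ∈ S, l.IsPrefix r ∧ m.IsPrefix r
  exists_append_mem : ∀ {l : Λ.Mor}, l ∈ S → ∀ E : Finset (Λ.Out l.2.1),
    Λ.Exhaustive (E : Set (Λ.Out l.2.1)) → ∃ e ∈ E, l.append e ∈ S

namespace Path

theorem isBoundary_iff_exists_append_mem (x : Λ.Path) :
    x.IsBoundary ↔ ∀ l ∈ x.initials, ∀ E : Finset (Λ.Out l.2.1),
      Λ.Exhaustive (E : Set (Λ.Out l.2.1)) → ∃ e ∈ E, l.append e ∈ x.initials := by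
  constructor
  · rintro hx _ ⟨n, rfl⟩ E hE
    obtain ⟨e, he, q, h, -, hs⟩ := hx n E hE
    refine ⟨e, he, q, ?_⟩
    rw [← x.initial_append_segment h, hs]
  · intro hx n E hE
    obtain ⟨e, he, q, hq⟩ := hx (x.initial n) ⟨n, rfl⟩ E hE
    have hdeg : q.1 = n.1 + Λ.deg e.2 := by
      have := congrArg Mor.degree hq
      rwa [Mor.degree_append, degree_initial, degree_initial] at this
    have h : n ≤ q := by
      change n.1 ≤ q.1
      rw [hdeg]
      exact le_self_add
    refine ⟨e, he, q, h, hdeg, ?_⟩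
    rw [← x.initial_append_segment h] at hq
    exact Mor.append_injective _ hq

theorem mem_initials_of_isPrefix {x : Λ.Path} {l m : Λ.Mor} (h : l.IsPrefix m)
    (hm : m ∈ x.initials) : l ∈ x.initials := by
  obtain ⟨q, rfl⟩ := hm
  have hle := h.degree_le
  rw [degree_initial] at hle
  let p : Box x.degree := ⟨l.degree, fun i => le_trans (by exact_mod_cast hle i) (q.2 i)⟩
  have hp : p ≤ q := hle
  exact ⟨p, (h.eq_of_degree_eq (x.initial_isPrefix hp) (x.degree_initial p).symm).symm⟩

theorem exists_isPrefix_of_mem_initials {x : Λ.Path} {l m : Λ.Mor} (hl : l ∈ x.initials)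
    (hm : m ∈ x.initials) : ∃ r ∈ x.initials, l.IsPrefix r ∧ m.IsPrefix r := by
  obtain ⟨p, rfl⟩ := hl
  obtain ⟨q, rfl⟩ := hm
  let r : Box x.degree := ⟨p.1 ⊔ q.1, fun i => by
    rcases le_total (p.1 i) (q.1 i) with h | h
    · simpa [h] using q.2 i
    · simpa [h] using p.2 i⟩
  exact ⟨x.initial r, ⟨r, rfl⟩, x.initial_isPrefix (show p.1 ≤ p.1 ⊔ q.1 from le_sup_left),
    x.initial_isPrefix (show q.1 ≤ p.1 ⊔ q.1 from le_sup_right)⟩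

theorem IsBoundary.isBoundaryFilter {x : Λ.Path} (hx : x.IsBoundary) :
    IsBoundaryFilter x.initials where
  nonempty := ⟨x.initial (boxZero _), ⟨_, rfl⟩⟩
  of_isPrefix := mem_initials_of_isPrefix
  directed := exists_isPrefix_of_mem_initials
  exists_append_mem := fun hl => x.isBoundary_iff_exists_append_mem.1 hx _ hl

/-- A coherent family of paths is the family of initial segments of a path. -/
theorem exists_initial_eq (m : Fin k → ℕ∞) (L : Box m → Λ.Mor) (hdeg : ∀ n, (L n).degree = n.1)
    (hL : ∀ p q, p ≤ q → (L p).IsPrefix (L q)) :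
    ∃ x : Λ.Path, x.initials = Set.range L := by
  choose f hf using fun (p q : Box m) (h : p ⟶ q) => (hL p q (leOfHom h)).exists_hom
  -- Functoriality comes from cancellation: the connecting path from `L p` to `L q` is unique.
  have huniq : ∀ (p q : Box m) (g g' : (L p).2.1 ⟶ (L q).2.1),
      L q = (L p).append ⟨_, g⟩ → L q = (L p).append ⟨_, g'⟩ → g = g' := by
    intro p q g g' h h'
    have := Mor.append_injective _ (h.symm.trans h')
    simpa using this
  let x : Λ.Path :=
    { degree := m
      functor :=
        { obj := fun n => (L n).2.1
          map := fun {p q} h => f p q h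
          map_id := fun p => huniq p p _ _ (hf p p _) (by simp [Mor.append])
          map_comp := fun {p q r} g h => by
            refine huniq p r _ _ (hf p r _) ?_
            have : ∀ (a b : Λ.Mor) (hab : a = b) (c : Λ.Obj) (u : a.2.1 ⟶ c) (w : b.2.1 ⟶ c),
                u ≍ w → a.append ⟨c, u⟩ = b.append ⟨c, w⟩ := by
              rintro a _ rfl c u w huw
              rw [eq_of_heq huw]
            exact (hf q r h).trans ((this _ ((L p).append ⟨_, f p q g⟩) (hf p q g) _ (f q r h)
              (f q r h) HEq.rfl).trans
                (Mor.append_append (L p) ⟨_, f p q g⟩ ⟨_, f q r h⟩)) }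
      add_deg_map := by
        intro p q h
        have := congrArg Mor.degree (hf p q h)
        rw [Mor.degree_append, hdeg, hdeg] at this
        exact this.symm }
  refine ⟨x, ?_⟩
  -- Paths of degree `0` are identities. So `L 0` is an identity, and the segment of `x` from `0` to
  -- `n` is `L n` itself.
  have hid : ∀ (a b : Λ.Obj) (μ : a ⟶ b), Λ.deg μ = 0 → (⟨a, b, μ⟩ : Λ.Mor) = ⟨b, b, 𝟙 b⟩ := by
    intro a b μ hμ
    have h1 := Mor.IsPrefix.refl (⟨a, b, μ⟩ : Λ.Mor)
    have h2 : Mor.IsPrefix (⟨a, a, 𝟙 a⟩ : Λ.Mor) ⟨a, b, μ⟩ :=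
      ⟨⟨b, μ⟩, by simp [Mor.append]⟩
    have := h1.eq_of_degree_eq h2 (by simp only [Mor.degree]; rw [hμ, Λ.deg_id])
    cases this
    rfl
  refine congrArg Set.range (funext fun n => ?_)
  have h1 : L (boxZero m) = ⟨_, _, 𝟙 (L (boxZero m)).2.1⟩ := hid _ _ _ (hdeg (boxZero m))
  have h2 : L n = (L (boxZero m)).append ⟨_, f _ n (homOfLE (boxZero_le n))⟩ := hf _ n _
  have : ∀ (a : Λ.Mor) (b : Λ.Obj), a = ⟨b, b, 𝟙 b⟩ → ∀ (c : Λ.Obj) (u : a.2.1 ⟶ c),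
      a.append ⟨c, u⟩ = ⟨a.2.1, c, u⟩ := by
    rintro _ b rfl c u
    simp [Mor.append]
  exact ((h2.trans (this _ _ h1 _ _))).symm

end Path

/-- Each coordinate of `n` is reached by some member of `S`, since a supremum of natural numbers
above `n i` cannot be bounded by `n i - 1`; directedness combines the finitely many coordinates. -/
theorem IsBoundaryFilter.exists_le_degree {S : Set Λ.Mor} (hS : IsBoundaryFilter S)
    (n : Fin k → ℕ) (hn : ∀ i, (n i : ℕ∞) ≤ ⨆ l ∈ S, (l.degree i : ℕ∞)) :
    ∃ l ∈ S, n ≤ l.degree := by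
  have h1 : ∀ i, ∃ l ∈ S, n i ≤ l.degree i := by
    intro i
    by_contra! h
    obtain ⟨l, hl⟩ := hS.nonempty
    have hpos : 0 < n i := (Nat.zero_le _).trans_lt (h l hl)
    have h2 : ⨆ l ∈ S, (l.degree i : ℕ∞) ≤ ((n i - 1 : ℕ) : ℕ∞) :=
      iSup₂_le fun m hm => by exact_mod_cast Nat.le_sub_one_of_lt (h m hm)
    have h3 : n i ≤ n i - 1 := by exact_mod_cast (hn i).trans h2
    omega
  have h2 : ∀ s : Finset (Fin k), ∃ l ∈ S, ∀ i ∈ s, n i ≤ l.degree i := by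
    intro s
    induction s using Finset.induction_on with
    | empty =>
      obtain ⟨l, hl⟩ := hS.nonempty
      exact ⟨l, hl, by simp⟩
    | insert i s _ ih =>
      obtain ⟨l, hl, h⟩ := ih
      obtain ⟨m, hm, h'⟩ := h1 i
      obtain ⟨r, hr, hlr, hmr⟩ := hS.directed hl hm
      refine ⟨r, hr, fun j hj => ?_⟩
      rcases Finset.mem_insert.1 hj with rfl | hj
      · exact h'.trans (hmr.degree_le j)
      · exact (h j hj).trans (hlr.degree_le j)
  obtain ⟨l, hl, h⟩ := h2 Finset.univ
  exact ⟨l, hl, fun i => h i (Finset.mem_univ i)⟩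

theorem IsBoundaryFilter.exists_initials_eq {S : Set Λ.Mor} (hS : IsBoundaryFilter S) :
    ∃ x : Λ.BoundaryPath, x.1.initials = S := by
  -- The degree of the path is the coordinatewise supremum of the degrees in `S`; the member of `S`
  -- of each degree `n ≤ m` is its initial segment.
  let m : Fin k → ℕ∞ := fun i => ⨆ l ∈ S, (l.degree i : ℕ∞)
  have hex : ∀ n : Box m, ∃ l ∈ S, l.degree = n.1 := by
    intro n
    obtain ⟨l, hl, h⟩ := hS.exists_le_degree n.1 n.2
    obtain ⟨r, hr, hd⟩ := l.exists_isPrefix_degree_eq h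
    exact ⟨r, hS.of_isPrefix hr hl, hd⟩
  choose L hLS hLdeg using hex
  obtain ⟨x, hx⟩ := Path.exists_initial_eq m L hLdeg fun p q hpq => by
    obtain ⟨r, -, h1, h2⟩ := hS.directed (hLS p) (hLS q)
    refine h1.of_degree_le h2 ?_
    rw [hLdeg, hLdeg]
    exact hpq
  have hxS : x.initials = S := by
    rw [hx]
    apply Set.Subset.antisymm
    · rintro _ ⟨n, rfl⟩
      exact hLS n
    · intro l hl
      let n : Box m := ⟨l.degree, fun i =>
        le_iSup₂_of_le (f := fun (l : Λ.Mor) (_ : l ∈ S) => (l.degree i : ℕ∞)) l hl le_rfl⟩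
      obtain ⟨r, -, h1, h2⟩ := hS.directed (hLS n) hl
      exact ⟨n, h1.eq_of_degree_eq h2 (hLdeg n)⟩
  exact ⟨⟨x, x.isBoundary_iff_exists_append_mem.2 fun l hl => by
    rw [hxS] at hl ⊢
    exact hS.exists_append_mem hl⟩, hxS⟩

/-- The initial segments of a boundary path. -/
def BoundaryPath.initials (x : Λ.BoundaryPath) : Set Λ.Mor :=
  x.1.initials

theorem BoundaryPath.initials_injective :
    Function.Injective (BoundaryPath.initials (Λ := Λ)) :=
  fun _ _ h => Subtype.ext (Path.initials_injective h)

theorem BoundaryPath.isBoundaryFilter (x : Λ.BoundaryPath) : IsBoundaryFilter x.initials :=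
  x.2.isBoundaryFilter

theorem mem_cylinder_iff {a b : Λ.Obj} {μ : a ⟶ b} {x : Λ.BoundaryPath} :
    x ∈ cylinder μ ↔ (⟨a, b, μ⟩ : Λ.Mor) ∈ x.initials := by
  constructor
  · rintro ⟨p, q, h, hp, -, he⟩
    obtain rfl : p = Path.boxZero _ := Subtype.ext hp
    exact ⟨q, he⟩
  · rintro ⟨q, hq⟩
    refine ⟨Path.boxZero _, q, Path.boxZero_le q, rfl, ?_, hq⟩
    rw [← Path.degree_initial, hq]
    rfl

theorem mem_cylinderDiff_iff {a b : Λ.Obj} {μ : a ⟶ b} {F : Finset (Λ.Out b)}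
    {x : Λ.BoundaryPath} : x ∈ cylinderDiff μ F ↔ (⟨a, b, μ⟩ : Λ.Mor) ∈ x.initials ∧
      ∀ e ∈ F, Mor.append ⟨a, b, μ⟩ e ∉ x.initials := by
  simp only [cylinderDiff, Set.mem_sdiff, mem_cylinder_iff, Set.mem_iUnion, not_exists]
  rfl

end Filters

/-! ### The maps `μz ↦ νz` and the orbit relation -/

section Transfer

variable {k : ℕ} {Λ : HigherRankGraph.{v, u} k}

/-- The paths `τ` with `μτ ∈ S`, prefixed with `ν`, and their initial segments. -/
def transferFilter (S : Set Λ.Mor) {c : Λ.Obj} {a b : Λ.Obj} (μ : a ⟶ c) (ν : b ⟶ c) :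
    Set Λ.Mor :=
  {l | ∃ τ : Λ.Out c, Mor.append ⟨a, c, μ⟩ τ ∈ S ∧ l.IsPrefix (Mor.append ⟨b, c, ν⟩ τ)}

/-- By directedness, `S` is generated by its members extending `μ`; thus `transferFilter S μ μ` is
`S`. -/
theorem IsBoundaryFilter.mem_iff {S : Set Λ.Mor} (hS : IsBoundaryFilter S) {a c : Λ.Obj}
    {μ : a ⟶ c} (hμ : (⟨a, c, μ⟩ : Λ.Mor) ∈ S) {l : Λ.Mor} :
    l ∈ S ↔ ∃ τ : Λ.Out c, Mor.append ⟨a, c, μ⟩ τ ∈ S ∧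
      l.IsPrefix (Mor.append ⟨a, c, μ⟩ τ) := by
  constructor
  · intro hl
    obtain ⟨r, hr, ⟨τ, rfl⟩, h⟩ := hS.directed hμ hl
    exact ⟨τ, hr, h⟩
  · rintro ⟨τ, h1, h2⟩
    exact hS.of_isPrefix h2 h1

theorem IsBoundaryFilter.append_mem_transferFilter_iff {S : Set Λ.Mor}
    (hS : IsBoundaryFilter S) {a b c : Λ.Obj} {μ : a ⟶ c} {ν : b ⟶ c} {τ : Λ.Out c} :
    Mor.append ⟨b, c, ν⟩ τ ∈ transferFilter S μ ν ↔ Mor.append ⟨a, c, μ⟩ τ ∈ S := by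
  constructor
  · rintro ⟨τ', h1, ρ, h2⟩
    have h3 := Mor.append_injective _ (h2.trans (Mor.append_append ⟨b, c, ν⟩ τ ρ))
    subst h3
    refine hS.of_isPrefix ⟨ρ, ?_⟩ h1
    exact (Mor.append_append ⟨a, c, μ⟩ τ ρ).symm
  · intro h
    exact ⟨τ, h, Mor.IsPrefix.refl _⟩

theorem IsBoundaryFilter.transferFilter (halign : Λ.FinitelyAligned) {S : Set Λ.Mor}
    (hS : IsBoundaryFilter S) {a b c : Λ.Obj} {μ : a ⟶ c} (ν : b ⟶ c)
    (hμ : (⟨a, c, μ⟩ : Λ.Mor) ∈ S) : IsBoundaryFilter (transferFilter S μ ν) where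
  nonempty := ⟨⟨b, c, ν⟩, ⟨c, 𝟙 c⟩, by simpa [Mor.append] using hμ, Mor.isPrefix_append _ _⟩
  of_isPrefix := by
    rintro l m h ⟨τ, h1, h2⟩
    exact ⟨τ, h1, h.trans h2⟩
  directed := by
    rintro l m ⟨τ, h1, h2⟩ ⟨τ', h1', h2'⟩
    obtain ⟨_, hr, ⟨ρ, rfl⟩, ⟨ρ', h⟩⟩ := hS.directed h1 h1'
    have h3 := Mor.append_injective _ (((Mor.append_append ⟨a, c, μ⟩ τ ρ).symm.trans h).trans
      (Mor.append_append ⟨a, c, μ⟩ τ' ρ'))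
    have hr' := (Mor.append_append ⟨a, c, μ⟩ τ ρ) ▸ hr
    refine ⟨_, hS.append_mem_transferFilter_iff.2 hr', h2.trans ⟨ρ, ?_⟩, h2'.trans ⟨ρ', ?_⟩⟩
    · exact (Mor.append_append ⟨b, c, ν⟩ τ ρ).symm
    · exact (congrArg _ h3).trans (Mor.append_append ⟨b, c, ν⟩ τ' ρ').symm
  exists_append_mem := by
    rintro l ⟨τ, h1, ⟨σ, h2⟩⟩ E hE
    -- Here `ντ = lσ`. The set `Ext(σ; E)` is exhaustive at the source of `τ`, so `μτα ∈ S` for some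
    -- `α` in it; then `ντα = lσα` extends `le` for some `e ∈ E`.
    obtain ⟨E', hE', hEE'⟩ := hE.exists_ext halign σ
    have hc : τ.1 = σ.1 := congrArg (fun m : Λ.Mor => m.2.1) h2
    obtain ⟨d, τ⟩ := τ
    obtain ⟨d', σ⟩ := σ
    obtain rfl : d = d' := hc
    obtain ⟨α, hα, h3⟩ := hS.exists_append_mem h1 E' hE'
    obtain ⟨e, he, β, h4⟩ := hEE' α hα
    have h5 : (⟨α.1, σ ≫ α.2⟩ : Λ.Out l.2.1) = ⟨β.1, e.2 ≫ β.2⟩ := by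
      simpa only [Mor.append, Sigma.mk.injEq, true_and, heq_eq_eq] using h4
    have h6 : ∀ (a a' : Λ.Obj) (κ : a ⟶ d) (κ' : a' ⟶ d) (γ : Λ.Out d),
        (⟨a, d, κ⟩ : Λ.Mor) = ⟨a', d, κ'⟩ →
        Mor.append ⟨a, d, κ⟩ γ = Mor.append ⟨a', d, κ'⟩ γ := by
      intro a a' κ κ' γ h
      cases h
      rfl
    refine ⟨e, he, ⟨α.1, τ ≫ α.2⟩, ?_, ⟨β, ?_⟩⟩
    · exact (Mor.append_append ⟨a, c, μ⟩ ⟨d, τ⟩ α) ▸ h3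
    · calc Mor.append ⟨b, c, ν⟩ ⟨α.1, τ ≫ α.2⟩
          = Mor.append ⟨b, d, ν ≫ τ⟩ α := (Mor.append_append ⟨b, c, ν⟩ ⟨d, τ⟩ α).symm
        _ = Mor.append ⟨l.1, d, l.2.2 ≫ σ⟩ α := h6 _ _ _ _ α h2
        _ = l.append ⟨α.1, σ ≫ α.2⟩ := Mor.append_append l ⟨d, σ⟩ α
        _ = l.append ⟨β.1, e.2 ≫ β.2⟩ := by rw [h5]
        _ = (l.append e).append β := (Mor.append_append l e β).symm

theorem exists_transfer (halign : Λ.FinitelyAligned) {a b c : Λ.Obj} (μ : a ⟶ c) (ν : b ⟶ c) :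
    ∃ T : Λ.BoundaryPath → Λ.BoundaryPath, (∀ x, (⟨a, c, μ⟩ : Λ.Mor) ∈ x.initials →
      (T x).initials = transferFilter x.initials μ ν) ∧
      ∀ x, (⟨a, c, μ⟩ : Λ.Mor) ∉ x.initials → T x = x := by
  have : ∀ x : Λ.BoundaryPath, ∃ y : Λ.BoundaryPath, ((⟨a, c, μ⟩ : Λ.Mor) ∈ x.initials →
      y.initials = transferFilter x.initials μ ν) ∧
      ((⟨a, c, μ⟩ : Λ.Mor) ∉ x.initials → y = x) := by
    intro x
    by_cases h : (⟨a, c, μ⟩ : Λ.Mor) ∈ x.initials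
    · obtain ⟨y, hy⟩ := (x.isBoundaryFilter.transferFilter halign ν h).exists_initials_eq
      exact ⟨y, fun _ => hy, fun h' => absurd h h'⟩
    · exact ⟨x, fun h' => absurd h' h, fun _ => rfl⟩
  choose T h1 h2 using this
  exact ⟨T, h1, h2⟩

theorem Path.mem_initials_shift_iff {x : Λ.Path} {p : Box x.degree} {a c : Λ.Obj} {μ : a ⟶ c}
    (h : x.initial p = ⟨a, c, μ⟩) (τ : Λ.Out c) :
    (⟨c, τ⟩ : Λ.Mor) ∈ (x.shift p).initials ↔ Mor.append ⟨a, c, μ⟩ τ ∈ x.initials := by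
  have hin : ∀ n, x.initial (boxAdd p n) = (x.initial p).append
      (x.segment p (boxAdd p n) (fun i => Nat.le_add_right _ _)) := fun n =>
    (x.initial_append_segment _).symm
  have hshift : ∀ n, (x.shift p).initial n =
      ⟨x.vertex p, x.segment p (boxAdd p n) (fun i => Nat.le_add_right _ _)⟩ := fun n => rfl
  unfold Path.initial at h
  cases h
  constructor
  · rintro ⟨n, hn⟩
    rw [hshift] at hn
    refine ⟨boxAdd p n, (hin n).trans ?_⟩
    simp only [Sigma.mk.injEq, heq_eq_eq, true_and] at hn
    rw [hn]
    rfl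
  · rintro ⟨q, hq⟩
    have hdeg : q.1 = p.1 + Λ.deg τ.2 := by
      have := congrArg Mor.degree hq
      rw [Mor.degree_append, degree_initial] at this
      rw [this, ← degree_initial x p]
      rfl
    let n : Box (x.shift p).degree := ⟨Λ.deg τ.2, fun i => by
      have h2 := q.2 i
      rw [hdeg, Pi.add_apply, Nat.cast_add, add_comm] at h2
      exact ENat.le_sub_of_add_le_right (ENat.natCast_ne_top _) h2⟩
    have hnq : boxAdd p n = q := Subtype.ext hdeg.symm
    refine ⟨n, ?_⟩
    exact congrArg (Sigma.mk _) (Mor.append_injective _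
      ((hin n).symm.trans ((congrArg x.initial hnq).trans hq)))

theorem Path.range_eq_of_mem_initials {x : Λ.Path} {l : Λ.Mor} (h : l ∈ x.initials) :
    l.1 = x.vertex (boxZero _) := by
  obtain ⟨n, rfl⟩ := h
  rfl

/-- An arrow exists exactly when `x = μz` and `y = νz` for a common tail `z`; the lag plays no role
for orbits. -/
theorem nonempty_hom_iff (x y : Λ.BoundaryPath) : Nonempty (x ⟶ y) ↔
    ∃ (a b c : Λ.Obj) (μ : a ⟶ c) (ν : b ⟶ c), (⟨a, c, μ⟩ : Λ.Mor) ∈ x.initials ∧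
      (⟨b, c, ν⟩ : Λ.Mor) ∈ y.initials ∧ ∀ τ : Λ.Out c,
        Mor.append ⟨a, c, μ⟩ τ ∈ x.initials ↔ Mor.append ⟨b, c, ν⟩ τ ∈ y.initials := by
  constructor
  · rintro ⟨-, p, q, -, h⟩
    have hv : x.1.vertex p = y.1.vertex q := by
      have : ∀ z w : Λ.Path, z = w → z.vertex (Path.boxZero _) = w.vertex (Path.boxZero _) := by
        rintro z _ rfl
        rfl
      exact this _ _ h
    obtain ⟨b, ν, hν⟩ : ∃ (b : Λ.Obj) (ν : b ⟶ x.1.vertex p), y.1.initial q = ⟨b, _, ν⟩ := by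
      rw [hv]
      exact ⟨_, _, rfl⟩
    refine ⟨_, b, x.1.vertex p, _, ν, ⟨p, rfl⟩, ⟨q, hν⟩, fun τ => ?_⟩
    refine (Path.mem_initials_shift_iff (x := x.1) (p := p) rfl τ).symm.trans ?_
    rw [h]
    exact Path.mem_initials_shift_iff hν τ
  · rintro ⟨a, b, c, μ, ν, ⟨p, hp⟩, ⟨q, hq⟩, h⟩
    refine ⟨⟨fun i => (p.1 i : ℤ) - (q.1 i : ℤ), p, q, fun _ => rfl, ?_⟩⟩
    apply Path.initials_injective
    have hvx : (x.1.shift p).vertex (Path.boxZero _) = c :=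
      congrArg (fun l : Λ.Mor => l.2.1) hp
    have hvy : (y.1.shift q).vertex (Path.boxZero _) = c :=
      congrArg (fun l : Λ.Mor => l.2.1) hq
    ext ⟨d, τ⟩
    constructor
    · intro hl
      obtain rfl : d = c := (Path.range_eq_of_mem_initials hl).trans hvx
      exact (Path.mem_initials_shift_iff hq τ).2
        ((h τ).1 ((Path.mem_initials_shift_iff hp τ).1 hl))
    · intro hl
      obtain rfl : d = c := (Path.range_eq_of_mem_initials hl).trans hvy
      exact (Path.mem_initials_shift_iff hp τ).2
        ((h τ).2 ((Path.mem_initials_shift_iff hq τ).1 hl))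

end Transfer

/-! ### The topology of the boundary path space -/

section Topology

open Topology

variable {k : ℕ} {Λ : HigherRankGraph.{v, u} k}

theorem isOpen_cylinderDiff {a b : Λ.Obj} (μ : a ⟶ b) (F : Finset (Λ.Out b)) :
    IsOpen (cylinderDiff μ F) :=
  TopologicalSpace.isOpen_generateFrom_of_mem ⟨a, b, μ, F, rfl⟩

theorem isClopen_setOf_mem_initials (l : Λ.Mor) :
    IsClopen {x : Λ.BoundaryPath | l ∈ x.initials} := by
  constructor
  · rw [← isOpen_compl_iff, isOpen_iff_forall_mem_open]
    intro x hx
    obtain ⟨m, hm⟩ := x.isBoundaryFilter.nonempty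
    have hid : (⟨m.1, m.1, 𝟙 m.1⟩ : Λ.Mor) ∈ x.initials :=
      x.isBoundaryFilter.of_isPrefix ⟨m.2, by simp [Mor.append]⟩ hm
    -- If `l` starts at the range `v` of `x`, then `Z(v \ {l})` is a neighbourhood of `x` avoiding
    -- `l`; otherwise `Z(v)` is.
    by_cases h : m.1 = l.1
    · refine ⟨cylinderDiff (𝟙 l.1) {l.2}, ?_, isOpen_cylinderDiff _ _, ?_⟩
      · intro y hy
        have := (mem_cylinderDiff_iff.1 hy).2 l.2 (Finset.mem_singleton_self _)
        simpa [Mor.append] using this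
      · rw [mem_cylinderDiff_iff]
        refine ⟨h ▸ hid, ?_⟩
        intro e he
        rw [Finset.mem_singleton.1 he]
        simpa [Mor.append] using hx
    · refine ⟨cylinderDiff (𝟙 m.1) ∅, ?_, isOpen_cylinderDiff _ _, ?_⟩
      · intro y hy hl
        obtain ⟨r, -, h1, h2⟩ := y.isBoundaryFilter.directed (mem_cylinderDiff_iff.1 hy).1 hl
        exact h (h1.range_eq.trans h2.range_eq.symm)
      · rw [mem_cylinderDiff_iff]
        exact ⟨hid, by simp⟩
  · convert isOpen_cylinderDiff l.2.2 ∅ using 1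
    ext x
    rw [mem_cylinderDiff_iff]
    simp

/-- The sets `Z(μ \ F)` form a basis. -/
theorem exists_cylinderDiff_subset (halign : Λ.FinitelyAligned) {U : Set Λ.BoundaryPath}
    (hU : IsOpen U) {x : Λ.BoundaryPath} (hx : x ∈ U) :
    ∃ (a b : Λ.Obj) (μ : a ⟶ b) (F : Finset (Λ.Out b)),
      x ∈ cylinderDiff μ F ∧ cylinderDiff μ F ⊆ U := by
  induction hU with
  | basic s hs =>
    obtain ⟨a, b, μ, F, rfl⟩ := hs
    exact ⟨a, b, μ, F, hx, subset_rfl⟩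
  | univ =>
    obtain ⟨m, hm⟩ := x.isBoundaryFilter.nonempty
    exact ⟨_, _, m.2.2, ∅, mem_cylinderDiff_iff.2 ⟨hm, by simp⟩, Set.subset_univ _⟩
  | sUnion S _ ih =>
    obtain ⟨s, hs, hxs⟩ := hx
    obtain ⟨a, b, μ, F, h1, h2⟩ := ih s hs hxs
    exact ⟨a, b, μ, F, h1, h2.trans (Set.subset_sUnion_of_mem hs)⟩
  | inter s t _ _ ihs iht =>
    obtain ⟨a, b, μ, F, h1, h2⟩ := ihs hx.1
    obtain ⟨a', b', μ', F', h1', h2'⟩ := iht hx.2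
    rw [mem_cylinderDiff_iff] at h1 h1'
    obtain ⟨r, hr, hμ, hμ'⟩ := x.isBoundaryFilter.directed h1.1 h1'.1
    -- Inside `Z(r)`, avoiding `μe` amounts to avoiding the finitely many minimal common extensions
    -- of `r` and `μe`, so both exclusions can be rewritten as exclusions beyond `r`.
    have hfin : ∀ (a b : Λ.Obj) (μ : a ⟶ b) (F : Finset (Λ.Out b)),
        (⋃ e ∈ F, {α : Λ.Out r.2.1 | r.append α ∈
          r.minCommonExt (Mor.append ⟨a, b, μ⟩ e)}).Finite := fun a b μ F =>
      F.finite_toSet.biUnion fun e _ => Mor.finite_append_mem_minCommonExt halign _ _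
    have hmem : ∀ (a b : Λ.Obj) (μ : a ⟶ b) (F : Finset (Λ.Out b)),
        (∀ e ∈ F, Mor.append ⟨a, b, μ⟩ e ∉ x.initials) →
        ∀ α ∈ (hfin a b μ F).toFinset, r.append α ∉ x.initials := by
      intro a b μ F hF α hα hx
      obtain ⟨e, he, h⟩ := Set.mem_iUnion₂.1 ((hfin a b μ F).mem_toFinset.1 hα)
      exact hF e he (x.isBoundaryFilter.of_isPrefix h.2.1 hx)
    have hsub : ∀ (a b : Λ.Obj) (μ : a ⟶ b) (F : Finset (Λ.Out b)) (y : Λ.BoundaryPath),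
        r ∈ y.initials → Mor.IsPrefix ⟨a, b, μ⟩ r →
        (∀ α ∈ (hfin a b μ F).toFinset, r.append α ∉ y.initials) → y ∈ cylinderDiff μ F := by
      intro a b μ F y hy hμ hα
      refine mem_cylinderDiff_iff.2 ⟨y.isBoundaryFilter.of_isPrefix hμ hy, fun e he hey => ?_⟩
      obtain ⟨t, ht, h3, h4⟩ := y.isBoundaryFilter.directed hy hey
      obtain ⟨t', h5, h6⟩ := Mor.exists_mem_minCommonExt h3 h4
      obtain ⟨α, rfl⟩ := h5.1
      exact hα α ((hfin a b μ F).mem_toFinset.2 (Set.mem_biUnion he h5))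
        (y.isBoundaryFilter.of_isPrefix h6 ht)
    classical
    refine ⟨_, _, r.2.2, (hfin a b μ F).toFinset ∪ (hfin a' b' μ' F').toFinset, ?_, ?_⟩
    · refine mem_cylinderDiff_iff.2 ⟨hr, fun α hα => ?_⟩
      rcases Finset.mem_union.1 hα with hα | hα
      · exact hmem a b μ F h1.2 α hα
      · exact hmem a' b' μ' F' h1'.2 α hα
    · intro y hy
      obtain ⟨hry, hy⟩ := mem_cylinderDiff_iff.1 hy
      exact ⟨h2 (hsub a b μ F y hry hμ fun α hα => hy α (Finset.mem_union_left _ hα)),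
        h2' (hsub a' b' μ' F' y hry hμ' fun α hα => hy α (Finset.mem_union_right _ hα))⟩

open Classical in
/-- The indicator function of the set of initial segments. -/
noncomputable def BoundaryPath.indicator (x : Λ.BoundaryPath) : Λ.Mor → Bool :=
  fun l => decide (l ∈ x.initials)

theorem BoundaryPath.indicator_eq_true {x : Λ.BoundaryPath} {l : Λ.Mor} :
    x.indicator l = true ↔ l ∈ x.initials := by
  simp [indicator]

theorem continuous_iff_isClopen_mem_initials {X : Type*} [TopologicalSpace X]
    {f : X → Λ.Mor → Bool} : Continuous f ↔ ∀ l, IsClopen {x | f x l = true} := by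
  rw [continuous_pi_iff]
  exact forall_congr' fun l => continuous_bool_rng true

theorem BoundaryPath.isEmbedding_indicator :
    IsEmbedding (BoundaryPath.indicator (Λ := Λ)) := by
  refine ⟨⟨le_antisymm ?_ ?_⟩, ?_⟩
  · rw [← continuous_iff_le_induced, continuous_iff_isClopen_mem_initials]
    intro l
    simp only [indicator_eq_true]
    exact isClopen_setOf_mem_initials l
  · refine le_generateFrom ?_
    rintro _ ⟨a, b, μ, F, rfl⟩
    have hcl : ∀ l : Λ.Mor, IsClopen {f : Λ.Mor → Bool | f l = true} :=
      fun l => (isClopen_discrete {true}).preimage (continuous_apply l)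
    refine ⟨{f | f ⟨a, b, μ⟩ = true} ∩ ⋂ e ∈ F, {f | f (Mor.append ⟨a, b, μ⟩ e) = true}ᶜ,
      (hcl _).isOpen.inter (isOpen_biInter_finset fun e _ => (hcl _).compl.isOpen), ?_⟩
    ext x
    rw [mem_cylinderDiff_iff]
    simp only [Set.mem_preimage, Set.mem_inter_iff, Set.mem_iInter, Set.mem_compl_iff,
      Set.mem_ofPred_eq, indicator_eq_true]
  · intro x y h
    apply initials_injective
    ext l
    rw [← indicator_eq_true, h, indicator_eq_true]

/-- Directedness is phrased with minimal common extensions so that its existential ranges over a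
finite set when `Λ` is finitely aligned. It is then a closed condition; nonemptiness is open. -/
theorem BoundaryPath.range_indicator :
    Set.range (BoundaryPath.indicator (Λ := Λ)) =
      {f | ∃ l, f l = true} ∩
      ({f | ∀ l m : Λ.Mor, l.IsPrefix m → f m = true → f l = true} ∩
      {f | ∀ l m : Λ.Mor, f l = true → f m = true → ∃ r ∈ l.minCommonExt m, f r = true} ∩
      {f | ∀ (l : Λ.Mor) (E : Finset (Λ.Out l.2.1)), Λ.Exhaustive (E : Set (Λ.Out l.2.1)) →
        f l = true → ∃ e ∈ E, f (l.append e) = true}) := by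
  ext f
  constructor
  · rintro ⟨x, rfl⟩
    have hx := x.isBoundaryFilter
    simp only [Set.mem_inter_iff, Set.mem_ofPred_eq, indicator_eq_true]
    refine ⟨hx.nonempty, ⟨fun l m => hx.of_isPrefix, fun l m hl hm => ?_⟩,
      fun l E hE hl => hx.exists_append_mem hl E hE⟩
    obtain ⟨r, hr, h1, h2⟩ := hx.directed hl hm
    obtain ⟨r', h, h'⟩ := Mor.exists_mem_minCommonExt h1 h2
    exact ⟨r', h, hx.of_isPrefix h' hr⟩
  · rintro ⟨h1, ⟨h2, h3⟩, h4⟩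
    have hS : IsBoundaryFilter {l | f l = true} :=
      { nonempty := h1
        of_isPrefix := fun h hm => h2 _ _ h hm
        directed := fun hl hm => by
          obtain ⟨r, hr, h⟩ := h3 _ _ hl hm
          exact ⟨r, h, hr.1, hr.2.1⟩
        exists_append_mem := fun hl E hE => h4 _ E hE hl }
    obtain ⟨x, hx⟩ := hS.exists_initials_eq
    refine ⟨x, funext fun l => ?_⟩
    have : l ∈ x.initials ↔ f l = true := by
      change l ∈ x.1.initials ↔ _
      rw [hx]
      rfl
    rw [Bool.eq_iff_iff, indicator_eq_true, this]

theorem BoundaryPath.isLocallyClosed_range_indicator (halign : Λ.FinitelyAligned) :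
    IsLocallyClosed (Set.range (BoundaryPath.indicator (Λ := Λ))) := by
  have hcl : ∀ l : Λ.Mor, IsClopen {f : Λ.Mor → Bool | f l = true} :=
    fun l => (isClopen_discrete {true}).preimage (continuous_apply l)
  rw [range_indicator]
  refine ⟨_, _, ?_, IsClosed.inter (IsClosed.inter ?_ ?_) ?_, rfl⟩
  · rw [Set.ofPred_exists]
    exact isOpen_iUnion fun l => (hcl l).isOpen
  · simp only [Set.ofPred_forall]
    exact isClosed_iInter fun l => isClosed_iInter fun m => isClosed_iInter fun _ =>
      isClosed_imp (hcl m).isOpen (hcl l).isClosed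
  · simp only [Set.ofPred_forall]
    refine isClosed_iInter fun l => isClosed_iInter fun m =>
      isClosed_imp (hcl l).isOpen (isClosed_imp (hcl m).isOpen ?_)
    have := (Mor.finite_minCommonExt halign l m).isClosed_biUnion fun r _ => (hcl r).isClosed
    convert this using 1
    ext f
    simp
  · simp only [Set.ofPred_forall]
    refine isClosed_iInter fun l => isClosed_iInter fun E => isClosed_iInter fun _ =>
      isClosed_imp (hcl l).isOpen ?_
    have := E.finite_toSet.isClosed_biUnion fun e _ => (hcl (l.append e)).isClosed
    convert this using 1
    ext f
    simp

/-- On `Z(μ)`, the path `l` is an initial segment of `T x` when `μτ` is one of `x` for some `τ` with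
`ντ` a minimal common extension of `ν` and `l`. There are finitely many such `τ`, so this is a
clopen condition. -/
theorem continuous_of_initials_eq_transferFilter (halign : Λ.FinitelyAligned) {a b c : Λ.Obj}
    {μ : a ⟶ c} {ν : b ⟶ c} {T : Λ.BoundaryPath → Λ.BoundaryPath}
    (h1 : ∀ x, (⟨a, c, μ⟩ : Λ.Mor) ∈ x.initials →
      (T x).initials = transferFilter x.initials μ ν)
    (h2 : ∀ x, (⟨a, c, μ⟩ : Λ.Mor) ∉ x.initials → T x = x) : Continuous T := by
  rw [BoundaryPath.isEmbedding_indicator.continuous_iff, continuous_iff_isClopen_mem_initials]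
  intro l
  simp only [Function.comp_apply, BoundaryPath.indicator_eq_true]
  have key : {x : Λ.BoundaryPath | l ∈ (T x).initials} =
      ({x | (⟨a, c, μ⟩ : Λ.Mor) ∈ x.initials} ∩
        ⋃ τ ∈ {τ | Mor.append ⟨b, c, ν⟩ τ ∈ Mor.minCommonExt ⟨b, c, ν⟩ l},
          {x | Mor.append ⟨a, c, μ⟩ τ ∈ x.initials}) ∪
      ({x | (⟨a, c, μ⟩ : Λ.Mor) ∈ x.initials}ᶜ ∩ {x | l ∈ x.initials}) := by
    ext x
    simp only [Set.mem_union, Set.mem_inter_iff, Set.mem_compl_iff, Set.mem_ofPred_eq,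
      Set.mem_iUnion, exists_prop]
    by_cases h : (⟨a, c, μ⟩ : Λ.Mor) ∈ x.initials
    · simp only [h, h1 x h, true_and, not_true_eq_false, false_and, or_false]
      constructor
      · rintro ⟨τ, hτ, hl⟩
        obtain ⟨r, hr, ρ, hρ⟩ :=
          Mor.exists_mem_minCommonExt (Mor.isPrefix_append ⟨b, c, ν⟩ τ) hl
        obtain ⟨σ, rfl⟩ := hr.1
        have := Mor.append_injective _ (hρ.trans (Mor.append_append ⟨b, c, ν⟩ σ ρ))
        subst this
        exact ⟨σ, hr, x.isBoundaryFilter.of_isPrefix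
          ⟨ρ, (Mor.append_append ⟨a, c, μ⟩ σ ρ).symm⟩ hτ⟩
      · rintro ⟨τ, hτ, hx⟩
        exact ⟨τ, hx, hτ.2.1⟩
    · simp [h, h2 x h]
  rw [key]
  refine ((isClopen_setOf_mem_initials _).inter (Set.Finite.isClopen_biUnion ?_ ?_)).union
    ((isClopen_setOf_mem_initials _).compl.inter (isClopen_setOf_mem_initials _))
  · exact Mor.finite_append_mem_minCommonExt halign _ _
  · exact fun τ _ => isClopen_setOf_mem_initials _

/-- Pairs of paths with the same source. -/
abbrev SourcePair (Λ : HigherRankGraph.{v, u} k) : Type (max u v) :=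
  Σ c : Λ.Obj, (Σ a : Λ.Obj, (a ⟶ c)) × (Σ b : Λ.Obj, (b ⟶ c))

theorem IsCountable.countable_sourcePair (hcount : Λ.IsCountable) : Countable Λ.SourcePair := by
  have : Countable Λ.Mor := hcount
  refine Function.Injective.countable (f := fun t : Λ.SourcePair =>
    ((⟨t.2.1.1, t.1, t.2.1.2⟩, ⟨t.2.2.1, t.1, t.2.2.2⟩) : Λ.Mor × Λ.Mor)) ?_
  rintro ⟨c, ⟨a, μ⟩, ⟨b, ν⟩⟩ ⟨c', ⟨a', μ'⟩, ⟨b', ν'⟩⟩ h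
  obtain ⟨h1, h2⟩ := Prod.mk.inj h
  cases h1
  cases h2
  rfl

theorem t0Space_orbitSpace_iff (hcount : Λ.IsCountable) (halign : Λ.FinitelyAligned) :
    T0Space (OrbitSpace Λ.BoundaryPath) ↔
      ∀ x : Λ.BoundaryPath, ∃ U, IsOpen U ∧ U ∩ groupoidOrbit x = {x} := by
  have : Countable Λ.Mor := hcount
  have := hcount.countable_sourcePair
  have hemb := BoundaryPath.isEmbedding_indicator (Λ := Λ)
  have : T2Space Λ.BoundaryPath := hemb.t2Space
  have : SecondCountableTopology Λ.BoundaryPath := hemb.secondCountableTopology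
  have : LocallyCompactSpace Λ.BoundaryPath := hemb.isInducing.locallyCompactSpace
    (BoundaryPath.isLocallyClosed_range_indicator halign)
  choose T hT1 hT2 using fun t : Λ.SourcePair => exists_transfer halign t.2.1.2 t.2.2.2
  refine t0Space_quotient_iff_isolated (orbitSetoid Λ.BoundaryPath) T
    (fun t => continuous_of_initials_eq_transferFilter halign (hT1 t) (hT2 t)) ?_ ?_
  · rintro t x
    by_cases h : (⟨t.2.1.1, t.1, t.2.1.2⟩ : Λ.Mor) ∈ x.initials
    · have hx := x.isBoundaryFilter
      refine (nonempty_hom_iff _ _).2 ⟨_, _, _, _, t.2.2.2, h, ?_, fun τ => ?_⟩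
      · rw [hT1 t x h]
        exact ⟨⟨t.1, 𝟙 _⟩, by simpa [Mor.append] using h, Mor.isPrefix_append _ _⟩
      · rw [hT1 t x h]
        exact hx.append_mem_transferFilter_iff.symm
    · rw [hT2 t x h]
  · intro x y hxy
    obtain ⟨a, b, c, μ, ν, hμ, hν, h⟩ := (nonempty_hom_iff x y).1 hxy
    let t : Λ.SourcePair := ⟨c, ⟨a, μ⟩, ⟨b, ν⟩⟩
    refine ⟨t, ?_, {z | (⟨a, c, μ⟩ : Λ.Mor) ∈ z.initials},
      (isClopen_setOf_mem_initials _).isOpen, hμ, ?_⟩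
    · apply BoundaryPath.initials_injective
      rw [hT1 t x hμ]
      ext l
      rw [y.isBoundaryFilter.mem_iff hν]
      exact exists_congr fun τ => and_congr_left fun _ => h τ
    · intro z hz w hw hzw
      apply BoundaryPath.initials_injective
      -- The transferred filter remembers which `μτ` lie in the original one, and these generate it;
      -- hence injectivity on `Z(μ)`.
      have h3 : transferFilter z.initials μ ν = transferFilter w.initials μ ν := by
        rw [← hT1 t z hz, ← hT1 t w hw, hzw]
      ext l
      rw [z.isBoundaryFilter.mem_iff hz, w.isBoundaryFilter.mem_iff hw]
      refine exists_congr fun τ => and_congr_left fun _ => ?_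
      rw [← z.isBoundaryFilter.append_mem_transferFilter_iff (ν := ν), h3,
        w.isBoundaryFilter.append_mem_transferFilter_iff]

end Topology
end HigherRankGraph

/-! ### Discrete orbits and the conclusion -/

theorem discreteTopology_groupoidOrbit_iff {G : Type u} [Groupoid.{v} G] [TopologicalSpace G] :
    (∀ x : G, DiscreteTopology (groupoidOrbit x)) ↔
      ∀ x : G, ∃ U, IsOpen U ∧ U ∩ groupoidOrbit x = {x} := by
  have horb : ∀ {x y : G}, y ∈ groupoidOrbit x → groupoidOrbit y = groupoidOrbit x := by
    rintro x y ⟨f⟩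
    ext z
    exact ⟨fun ⟨g⟩ => ⟨f ≫ g⟩, fun ⟨g⟩ => ⟨Groupoid.inv f ≫ g⟩⟩
  constructor
  · intro h x
    have := h x
    have hx : x ∈ groupoidOrbit x := ⟨𝟙 x⟩
    obtain ⟨U, hU, hUx⟩ := isOpen_induced_iff.1
      (isOpen_discrete ({⟨x, hx⟩} : Set (groupoidOrbit x)))
    refine ⟨U, hU, Set.Subset.antisymm ?_ ?_⟩
    · rintro z ⟨hzU, hz⟩
      have : (⟨z, hz⟩ : groupoidOrbit x) ∈ Subtype.val ⁻¹' U := hzU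
      rw [hUx] at this
      exact congrArg Subtype.val this
    · rintro z rfl
      have : (⟨z, hx⟩ : groupoidOrbit z) ∈ Subtype.val ⁻¹' U := by
        rw [hUx]
        rfl
      exact ⟨this, hx⟩
  · intro h x
    rw [discreteTopology_iff_isOpen_singleton]
    rintro ⟨y, hy⟩
    obtain ⟨U, hU, hUy⟩ := h y
    rw [horb hy] at hUy
    refine isOpen_induced_iff.2 ⟨U, hU, ?_⟩
    ext ⟨z, hz⟩
    have : z ∈ U ∩ groupoidOrbit x ↔ z = y := by rw [hUy]; rfl
    simpa [hz] using this

theorem propositionp {k : ℕ} (Λ : HigherRankGraph.{v, u} k) (hcount : Λ.IsCountable)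
    (halign : Λ.FinitelyAligned) :
    (T0Space (OrbitSpace Λ.BoundaryPath) ↔
      ∀ x : Λ.BoundaryPath, ∃ (a b : Λ.Obj) (μ : a ⟶ b) (F : Finset (Λ.Out b)),
        HigherRankGraph.cylinderDiff μ F ∩ groupoidOrbit x = {x}) ∧
    (T0Space (OrbitSpace Λ.BoundaryPath) ↔
      ∀ x : Λ.BoundaryPath, DiscreteTopology (groupoidOrbit x)) := by
  rw [discreteTopology_groupoidOrbit_iff,
    HigherRankGraph.t0Space_orbitSpace_iff hcount halign]
  refine ⟨forall_congr' fun x => ⟨?_, ?_⟩, Iff.rfl⟩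
  · rintro ⟨U, hU, hUx⟩
    have hx : x ∈ U ∩ groupoidOrbit x := by rw [hUx]; rfl
    -- Shrinking an isolating open set to a basic neighbourhood of `x` keeps it isolating.
    obtain ⟨a, b, μ, F, h1, h2⟩ := HigherRankGraph.exists_cylinderDiff_subset halign hU hx.1
    refine ⟨a, b, μ, F, Set.Subset.antisymm ?_ ?_⟩
    · rw [← hUx]
      exact Set.inter_subset_inter_left _ h2
    · rintro z rfl
      exact ⟨h1, hx.2⟩
  · rintro ⟨a, b, μ, F, h⟩
    exact ⟨_, HigherRankGraph.isOpen_cylinderDiff μ F, h⟩
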